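/- Let $a,b,t>0$ and $c,r\in\mathbb{R}$ with $r\neq -c/b$, and let $W_0(x)=1$, $W_1(x)=t(x-r)$ and $W_n(x)=aW_{n-1}(x)+(bx+c)W_{n-2}(x)$ for $n\ge 2$. For finite sets of reals $X=\{x_1<\dots<x_s\}$ ($s\ge1$) and $Y=\{y_1<\dots<y_m\}$ write $X\bowtie Y$ if $m=s-1$ and $x_1<y_1<x_2<\dots<y_{s-1}<x_s$, and write $X\rtimes Y$ if either $X\bowtie Y$, or $m=s$ and $y_1<x_1<y_2<x_2<\dots<y_s<x_s$. Write $u_n\nearrow u$ (resp. $u_n\searrow u$) if the sequence, over the indices for which it is defined, is strictly increasing (resp. decreasing) and converges to $u$. The best bound of a set $S\subseteq\mathbb{R}$ is the smallest interval containing $S$. Then for every $n\ge0$ the polynomial $W_n$ has degree $d_n=\lfloor (n+1)/2\rfloor$ and all its complex roots are real and simple. Let $R_n=\{\xi_{n,1}<\dots<\xi_{n,d_n}\}$ be its zero set, let $R_n'=R_n\setminus\{\xi_{n,d_n}\}$, and put $$x^*=-\frac{4c+a^2}{4b},\qquad r^*=x^*-\frac{a}{2t},\qquad y^*=r+\frac{(at+b)-\sqrt{(at+b)^2+4t^2(br+c)}}{2t^2}.$$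 (i) If $r\le r^*$, then $R_{n+1}\rtimes R_n$ and $R_{n+2}\bowtie R_n$ for all $n\ge1$; $\xi_{n,d_n-i}\nearrow x^*$ as $n\to\infty$ for every fixed $i\ge0$; and the best bound of $\bigcup_{n\ge1}R_n$ is $(-\infty,x^*)$. (ii) If $r^*<r<-c/b$, then $R_{n+1}\rtimes R_n$ and $R_{n+2}\bowtie R_n$ for all $n\ge1$; $\xi_{n,d_n-i}\nearrow x^*$ for every fixed $i\ge1$; $\xi_{n,d_n}\nearrow y^*$, where $x^*<y^*$; and the best bound of $\bigcup_{n\ge1}R_n$ is $(-\infty,y^*)$. (iii) If $r>-c/b$, then $R'_{n+1}\rtimes R'_n$ and $R'_{n+2}\bowtie R'_n$ for all $n\ge3$; $\xi_{n,d_n-i}\nearrow x^*$ for every fixed $i\ge1$; $\xi_{2n,d_{2n}}\nearrow y^*$ and $\xi_{2n-1,d_{2n-1}}\searrow y^*$ ($n\ge1$), where $x^*<-c/b<\xi_{2,d_2}<y^*<\xi_{1,d_1}=r$; and the best bound of $\bigcup_{n\ge1}R_n$ is $(-\infty,r]$. Furthermore, in all three cases $\xi_{n,i}\to-\infty$ as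 $n\to\infty$ for every fixed $i\ge1$. -/

import Mathlib

open Polynomial Filter Topology

/-- A real polynomial is distinct-real-rooted if all its complex roots, counted with
multiplicity, are distinct and real. -/
def DistinctRealRooted (p : ℝ[X]) : Prop :=
  (p.map (algebraMap ℝ ℂ)).roots.Nodup ∧ ∀ z ∈ (p.map (algebraMap ℝ ℂ)).roots, z.im = 0

/-- The set of real zeros of a (nonzero) real polynomial. -/
noncomputable def zeroSet (p : ℝ[X]) : Finset ℝ := p.roots.toFinset

/-- The `i`-th smallest element of a finite set of reals, counting from `i = 1`;
the value `0` outside the range `1 ≤ i ≤ |S|` is never used. -/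
noncomputable def nth (S : Finset ℝ) (i : ℕ) : ℝ :=
  if h : 1 ≤ i ∧ i ≤ S.card then S.orderEmbOfFin rfl ⟨i - 1, by omega⟩ else 0

/-- `X` interlaces `Y` from both sides: `|Y| = |X| - 1` and
`x₁ < y₁ < x₂ < y₂ < ⋯ < x_{s-1} < y_{s-1} < x_s`. -/
def InterlacesBoth (X Y : Finset ℝ) : Prop :=
  X.card = Y.card + 1 ∧
    ∀ j, 1 ≤ j → j ≤ Y.card → nth X j < nth Y j ∧ nth Y j < nth X (j + 1)

/-- `X` (nonempty) interlaces `Y` from the right: either `X` interlaces `Y` from both sides,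
or `|X| = |Y|` and `y₁ < x₁ < y₂ < x₂ < ⋯ < y_s < x_s`. -/
def InterlacesRight (X Y : Finset ℝ) : Prop :=
  InterlacesBoth X Y ∨
    (1 ≤ X.card ∧ X.card = Y.card ∧
      ∀ j, 1 ≤ j → j ≤ X.card → nth Y j < nth X j ∧ (j < X.card → nth X j < nth Y (j + 1)))

/-- The set with its largest element removed. -/
noncomputable def dropMax (S : Finset ℝ) : Finset ℝ := S.erase (nth S S.card)

/-- The sequence `u N, u (N+1), …` converges to `x` (strictly) increasingly. -/
def IncreasesTo (u : ℕ → ℝ) (N : ℕ) (x : ℝ) : Prop :=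
  StrictMonoOn u (Set.Ici N) ∧ Tendsto u atTop (𝓝 x)

/-- The sequence `u N, u (N+1), …` converges to `x` (strictly) decreasingly. -/
def DecreasesTo (u : ℕ → ℝ) (N : ℕ) (x : ℝ) : Prop :=
  StrictAntiOn u (Set.Ici N) ∧ Tendsto u atTop (𝓝 x)

/-- `I` is the best bound of `S`: the smallest interval of reals (bounded or not, with or
without endpoints) that contains `S`. -/
def IsBestBound (S I : Set ℝ) : Prop :=
  IsLeast {J : Set ℝ | J.OrdConnected ∧ S ⊆ J} I

/-- The limit point `x* = -(4c + a²) / (4b)`. -/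
noncomputable def xStar (a b c : ℝ) : ℝ := -(4 * c + a ^ 2) / (4 * b)

/-- The threshold `r* = x* - a / (2t)`. -/
noncomputable def rStar (a b c t : ℝ) : ℝ := xStar a b c - a / (2 * t)

/-- The limit point
`y* = r + ((at + b) - √((at + b)² + 4t²(br + c))) / (2t²)`. -/
noncomputable def yStar (a b c t r : ℝ) : ℝ :=
  r + ((a * t + b) - √((a * t + b) ^ 2 + 4 * t ^ 2 * (b * r + c))) / (2 * t ^ 2)

/-! All zeros are counted from the top of their zero set (`descRoot W n k` is the `k`-th largest
zero of `W n`, from `k = 0`). In these terms `R_{n+1} ⋊ R_n` and `R_{n+2} ⋈ R_n` both say that the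
zeros alternate downwards, beginning with the larger set, and `ξ_{n, d_n - i} ↗` follows from the
first of them. Whenever a polynomial with positive leading coefficient alternates in sign along a
decreasing list of points whose length is its degree, or one less, its zeros are real and simple
and interlace the list (`simpleRealRooted_of_alternating`); this lemma is used with three lists.

* Left of `x*` the characteristic roots of the recurrence are `ρ exp (± i θ)`, and
  `W n sin θ = ρ ^ (n - 1) (W 1 sin (n θ) - ρ sin ((n - 1) θ))`. At `θ = k π / n` this gives
  `W n = (-1) ^ k ρ ^ n`, whatever `W 1` is (`eval_node`). Hence all zeros are real and simple, and
  these explicit nodes separate them (`localization`). A node tends to `x*` when its angle tends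
  to `0` and to `-∞` when its angle tends to `π / 2`, so the zeros of fixed index from the top, the
  largest excepted, tend to `x*`, and those of fixed index from below tend to `-∞`.
* If `r < -c / b`, all zeros lie left of `-c / b`. There `W (n + 2) = (b x + c) W n` at a zero of
  `W (n + 1)` has the sign opposite to `W n`, so by induction `W (n + 1)` alternates along the zeros
  of `W n` (`sign_eval_of_lt`); so does `W (n + 2)`, being `a W (n + 1)` there.
* If `r > -c / b`, then `W n < 0` at `-c / b` for `n ≥ 1`, and the same induction works with the
  largest zero of `W n` replaced by `-c / b` (`sign_eval_of_gt`). The largest zeros lie right of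
  `-c / b`, where `b x + c > 0`, which makes them alternate
  (`eval_descRoot_zero_alternating`).

The limit of the largest zero is `x*` if `r ≤ r*`, as then `W n > 0` on `[x*, ∞)`. If `r > r*`,
Binet's formula shows that for `x > x*` the sign of `W n x` is eventually that of
`W 1 x - μ x`, where `μ = a / 2 - √(b (x - x*))` is the smaller characteristic root. This difference
increases with `x` and vanishes at `y*` (`yStar_spec`), so the largest zero tends to `y*`. -/

/-! ### Finite sets of reals counted from the top -/

/-- The elements of a finite set of reals in decreasing order: `desc S k` is the element with
exactly `k` elements above it. Only indices `k < S.card` are meaningful. -/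
noncomputable def desc (S : Finset ℝ) (k : ℕ) : ℝ := nth S (S.card - k)

theorem desc_mem {S : Finset ℝ} {k : ℕ} (hk : k < S.card) : desc S k ∈ S := by
  rw [desc, nth, dif_pos ⟨by omega, by omega⟩]
  exact Finset.orderEmbOfFin_mem _ _ _

theorem desc_lt_desc {S : Finset ℝ} {i j : ℕ} (hij : i < j) (hj : j < S.card) :
    desc S j < desc S i := by
  rw [desc, desc, nth, nth, dif_pos ⟨by omega, by omega⟩, dif_pos ⟨by omega, by omega⟩]
  apply (S.orderEmbOfFin rfl).strictMono
  rw [Fin.mk_lt_mk]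
  omega

theorem desc_le_desc {S : Finset ℝ} {i j : ℕ} (hij : i ≤ j) (hj : j < S.card) :
    desc S j ≤ desc S i := by
  rcases hij.eq_or_lt with rfl | h
  · exact le_rfl
  · exact (desc_lt_desc h hj).le

theorem nth_eq_desc {S : Finset ℝ} {i : ℕ} (hi : i ≤ S.card) : nth S i = desc S (S.card - i) := by
  rw [desc, Nat.sub_sub_self hi]

/-- A decreasing listing of a finite set is the one given by `desc`. -/
theorem desc_image {p : ℕ} {α : ℕ → ℝ} (hα : ∀ i j, i < j → j < p → α j < α i) :
    ((Finset.range p).image α).card = p ∧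
      ∀ k < p, desc ((Finset.range p).image α) k = α k := by
  have hcard : ((Finset.range p).image α).card = p := by
    rw [Finset.card_image_of_injOn, Finset.card_range]
    intro i hi j hj hij
    simp only [Finset.coe_range, Set.mem_Iio] at hi hj
    rcases lt_trichotomy i j with h | h | h
    · exact absurd hij (hα i j h hj).ne'
    · exact h
    · exact absurd hij (hα j i h hi).ne
  refine ⟨hcard, fun k hk => ?_⟩
  have hmem : ∀ j < p, α j ∈ (Finset.range p).image α := fun j hj =>
    Finset.mem_image_of_mem _ (Finset.mem_range.2 hj)
  generalize (Finset.range p).image α = S at *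
  have := Finset.orderEmbOfFin_unique (s := S) rfl (f := fun i => α (p - 1 - i.1))
    (fun i => hmem _ (by omega))
    (fun i j hij => hα _ _ (by have := Fin.lt_def.1 hij; omega) (by omega))
  rw [desc, nth, dif_pos ⟨by omega, by omega⟩, ← this]
  change α (p - 1 - (S.card - k - 1)) = α k
  congr 1
  omega

theorem image_desc (S : Finset ℝ) : (Finset.range S.card).image (desc S) = S := by
  apply Finset.eq_of_subset_of_card_le
  · intro x hx
    obtain ⟨k, hk, rfl⟩ := Finset.mem_image.1 hx
    exact desc_mem (Finset.mem_range.1 hk)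
  · rw [(desc_image fun i j hij hj => desc_lt_desc hij hj).1]

theorem exists_desc_eq {S : Finset ℝ} {x : ℝ} (hx : x ∈ S) : ∃ k < S.card, desc S k = x := by
  rw [← image_desc S] at hx
  obtain ⟨k, hk, rfl⟩ := Finset.mem_image.1 hx
  exact ⟨k, Finset.mem_range.1 hk, rfl⟩

theorem card_dropMax {S : Finset ℝ} (hS : 0 < S.card) : (dropMax S).card = S.card - 1 :=
  Finset.card_erase_of_mem (desc_mem (k := 0) hS)

theorem desc_dropMax {S : Finset ℝ} {k : ℕ} (hk : k + 1 < S.card) :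
    desc (dropMax S) k = desc S (k + 1) := by
  have h := desc_image (p := S.card - 1) (α := fun k => desc S (k + 1))
    fun i j hij hj => desc_lt_desc (by omega) (by omega)
  have : (Finset.range (S.card - 1)).image (fun k => desc S (k + 1)) = dropMax S := by
    apply Finset.eq_of_subset_of_card_le
    · intro x hx
      obtain ⟨k, hk, rfl⟩ := Finset.mem_image.1 hx
      have hk := Finset.mem_range.1 hk
      exact Finset.mem_erase.2
        ⟨(desc_lt_desc (S := S) k.succ_pos (by omega)).ne, desc_mem (by omega)⟩
    · rw [h.1, card_dropMax (by omega)]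
  rw [← this]
  exact h.2 k (by omega)

/-- Counted from the top, both interlacing relations say the same thing:
`x₀ > y₀ > x₁ > y₁ > ⋯`. -/
theorem interlacesBoth_of_desc {X Y : Finset ℝ} (hc : X.card = Y.card + 1)
    (h : ∀ k < Y.card, desc Y k < desc X k ∧ desc X (k + 1) < desc Y k) : InterlacesBoth X Y := by
  refine ⟨hc, fun j h1 hj => ?_⟩
  have := h (Y.card - j) (by omega)
  rw [nth_eq_desc hj, nth_eq_desc (S := X) (i := j) (by omega),
    nth_eq_desc (S := X) (i := j + 1) (by omega)]
  rw [show X.card - j = Y.card - j + 1 by omega, show X.card - (j + 1) = Y.card - j by omega]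
  exact ⟨this.2, this.1⟩

theorem interlacesRight_of_desc {X Y : Finset ℝ} (h0 : 1 ≤ X.card)
    (hc : X.card = Y.card ∨ X.card = Y.card + 1)
    (h : ∀ k < Y.card, desc Y k < desc X k)
    (h' : ∀ k < Y.card, k + 1 < X.card → desc X (k + 1) < desc Y k) : InterlacesRight X Y := by
  rcases hc with hc | hc
  · refine Or.inr ⟨h0, hc, fun j h1 hj => ⟨?_, fun hj' => ?_⟩⟩
    · rw [nth_eq_desc hj, nth_eq_desc (S := Y) (by omega), hc]
      exact h _ (by omega)
    · rw [nth_eq_desc hj, nth_eq_desc (S := Y) (by omega),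
        show X.card - j = Y.card - (j + 1) + 1 by omega]
      exact h' _ (by omega) (by omega)
  · exact Or.inl (interlacesBoth_of_desc hc fun k hk => ⟨h k hk, h' k hk (by omega)⟩)

/-! ### Polynomials with simple real zeros -/

/-- A real polynomial with positive leading coefficient and as many distinct real zeros as its
degree. -/
def SimpleRealRooted (P : ℝ[X]) : Prop :=
  0 < P.leadingCoeff ∧ (zeroSet P).card = P.natDegree

namespace SimpleRealRooted

variable {P : ℝ[X]}

theorem card_roots (h : SimpleRealRooted P) : P.roots.card = P.natDegree :=
  le_antisymm (card_roots' P) (h.2 ▸ Multiset.toFinset_card_le _)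

theorem nodup (h : SimpleRealRooted P) : P.roots.Nodup := by
  rw [← Multiset.toFinset_card_eq_card_iff_nodup, h.card_roots]
  exact h.2

theorem distinctRealRooted (h : SimpleRealRooted P) : DistinctRealRooted P := by
  have := roots_map_of_injective_of_card_eq_natDegree (algebraMap ℝ ℂ).injective h.card_roots
  rw [DistinctRealRooted, ← this]
  refine ⟨h.nodup.map (algebraMap ℝ ℂ).injective, fun z hz => ?_⟩
  obtain ⟨x, -, rfl⟩ := Multiset.mem_map.1 hz
  exact Complex.ofReal_im x

theorem eval_eq (h : SimpleRealRooted P) (x : ℝ) :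
    P.eval x = P.leadingCoeff * ∏ k ∈ Finset.range P.natDegree, (x - desc (zeroSet P) k) := by
  have h1 := C_leadingCoeff_mul_prod_multiset_X_sub_C h.card_roots
  have h2 : P.roots = (zeroSet P).val := by
    rw [zeroSet, Multiset.toFinset_val, h.nodup.dedup]
  have h3 : ∏ k ∈ Finset.range P.natDegree, (x - desc (zeroSet P) k) =
      ∏ s ∈ zeroSet P, (x - s) := by
    conv_rhs => rw [← image_desc (zeroSet P)]
    rw [Finset.prod_image, h.2]
    intro i hi j hj hij
    simp only [Finset.coe_range, Set.mem_Iio] at hi hj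
    rcases lt_trichotomy i j with h | h | h
    · exact absurd hij (desc_lt_desc h hj).ne'
    · exact h
    · exact absurd hij (desc_lt_desc h hi).ne
  rw [h3]
  conv_lhs => rw [← h1, h2]
  rw [eval_mul, eval_C, ← Finset.prod_eq_multiset_prod, eval_prod]
  simp

/-- At a point with exactly `j` zeros above it and no zero at it, the sign is `(-1) ^ j`. -/
theorem sign_eval (h : SimpleRealRooted P) {x : ℝ} {j : ℕ} (hj : j ≤ P.natDegree)
    (h1 : ∀ i < j, x < desc (zeroSet P) i)
    (h2 : j < P.natDegree → desc (zeroSet P) j < x) : 0 < (-1) ^ j * P.eval x := by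
  rw [h.eval_eq, ← Finset.prod_range_mul_prod_Ico _ hj]
  have e : (-1 : ℝ) ^ j * ∏ k ∈ Finset.range j, (x - desc (zeroSet P) k) =
      ∏ k ∈ Finset.range j, (desc (zeroSet P) k - x) := by
    conv_lhs => rw [← Finset.card_range j, ← Finset.prod_const, Finset.card_range,
      ← Finset.prod_mul_distrib]
    exact Finset.prod_congr rfl fun _ _ => by ring
  have p1 : 0 < ∏ k ∈ Finset.range j, (desc (zeroSet P) k - x) :=
    Finset.prod_pos fun k hk => sub_pos.2 (h1 k (Finset.mem_range.1 hk))
  have p2 : 0 < ∏ k ∈ Finset.Ico j P.natDegree, (x - desc (zeroSet P) k) :=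
    Finset.prod_pos fun k hk => by
      rw [Finset.mem_Ico] at hk
      have := h2 (by omega)
      have := desc_le_desc (S := zeroSet P) hk.1 (by rw [h.2]; exact hk.2)
      linarith
  rw [← e] at p1
  have := mul_pos (mul_pos p1 p2) h.1
  linarith

theorem eval_desc (h : SimpleRealRooted P) {k : ℕ} (hk : k < P.natDegree) :
    P.eval (desc (zeroSet P) k) = 0 := by
  have : desc (zeroSet P) k ∈ zeroSet P := desc_mem (by rw [h.2]; exact hk)
  exact isRoot_of_mem_roots (Multiset.mem_toFinset.1 this)

theorem lt_desc_zero_of_eval_neg (h : SimpleRealRooted P) {x : ℝ} (hp : 0 < P.natDegree)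
    (hx : P.eval x < 0) : x < desc (zeroSet P) 0 := by
  by_contra! hc
  rcases hc.eq_or_lt with hc | hc
  · rw [← hc, h.eval_desc hp] at hx
    exact hx.false
  · have := h.sign_eval (x := x) (Nat.zero_le _) (by simp) fun _ => hc
    simp at this
    linarith

theorem desc_zero_lt_of_eval_pos (h : SimpleRealRooted P) {x : ℝ} (hp : 0 < P.natDegree)
    (hx : 0 < P.eval x) (h1 : 1 < P.natDegree → desc (zeroSet P) 1 < x) :
    desc (zeroSet P) 0 < x := by
  by_contra! hc
  rcases hc.eq_or_lt with hc | hc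
  · rw [hc, h.eval_desc hp] at hx
    exact hx.false
  · have := h.sign_eval (x := x) (j := 1) hp (by intro i hi; simpa [Nat.lt_one_iff.1 hi]) h1
    simp at this
    linarith

end SimpleRealRooted

/-- The signs of a polynomial with positive leading coefficient far to the right and far to the
left. -/
theorem exists_large_sign {P : ℝ[X]} (hP : 0 < P.leadingCoeff) (B : ℝ) :
    ∃ M, B < M ∧ 0 < P.eval M ∧ 0 < (-1) ^ P.natDegree * P.eval (-M) := by
  have key : ∀ Q : ℝ[X], 0 < Q.leadingCoeff → ∀ᶠ x in atTop, 0 < Q.eval x := by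
    intro Q hQ
    rcases Nat.eq_zero_or_pos Q.natDegree with h0 | h0
    · rw [eq_C_of_natDegree_eq_zero h0] at hQ ⊢
      exact Eventually.of_forall fun x => by simpa using hQ
    · exact (Q.tendsto_atTop_of_leadingCoeff_nonneg (natDegree_pos_iff_degree_pos.1 h0)
        hQ.le).eventually_gt_atTop 0
  have h2 := key (C ((-1) ^ P.natDegree) * P.comp (-X)) (by
    rw [leadingCoeff_mul, leadingCoeff_C, leadingCoeff_comp (by simp), leadingCoeff_neg,
      leadingCoeff_X]
    have : (-1 : ℝ) ^ P.natDegree * (-1) ^ P.natDegree = 1 := by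
      rw [← mul_pow]; simp
    rw [mul_left_comm, this, mul_one]
    exact hP)
  obtain ⟨M, h⟩ := ((eventually_gt_atTop B).and ((key P hP).and h2)).exists
  refine ⟨M, h.1, h.2.1, ?_⟩
  simpa using h.2.2

/-- If a polynomial of degree `p ∈ {m, m + 1}` with positive leading coefficient has the sign
`(-1) ^ (k + 1)` at the `k`-th point (`k < m`) of a decreasing list, then its zeros are real and
simple and interlace that list, starting from the top. -/
theorem simpleRealRooted_of_alternating {P : ℝ[X]} {m : ℕ} {y : ℕ → ℝ}
    (hlead : 0 < P.leadingCoeff) (hp : P.natDegree = m ∨ P.natDegree = m + 1)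
    (hy : ∀ i j, i < j → j < m → y j < y i)
    (hsign : ∀ k < m, 0 < (-1) ^ (k + 1) * P.eval (y k)) :
    SimpleRealRooted P ∧ (∀ k < m, y k < desc (zeroSet P) k) ∧
      ∀ k < m, k + 1 < P.natDegree → desc (zeroSet P) (k + 1) < y k := by
  -- The list is extended at both ends by points far out.
  obtain ⟨M, hMB, hM1, hM2⟩ := exists_large_sign hlead (∑ k ∈ Finset.range m, |y k|)
  have hyM : ∀ k < m, |y k| < M := fun k hk =>
    (Finset.single_le_sum (f := fun k => |y k|) (fun _ _ => abs_nonneg _)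
      (Finset.mem_range.2 hk)).trans_lt hMB
  have hM0 : 0 < M := (Finset.sum_nonneg fun _ _ => abs_nonneg _).trans_lt hMB
  set z : ℕ → ℝ := fun k => if k = 0 then M else if k ≤ m then y (k - 1) else -M with hz
  have hz0 : z 0 = M := rfl
  have hzk : ∀ k < m, z (k + 1) = y k := fun k hk => by
    simp only [hz, Nat.add_eq_zero_iff, one_ne_zero, and_false, if_false, Nat.add_sub_cancel]
    rw [if_pos (by omega)]
  have hzm : z (m + 1) = -M := by
    simp only [hz, Nat.add_eq_zero_iff, one_ne_zero, and_false, if_false]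
    rw [if_neg (by omega)]
  have hzlt : ∀ k < m + 1, z (k + 1) < z k := by
    intro k hk
    rcases Nat.eq_zero_or_pos k with rfl | hk0
    · rcases Nat.eq_zero_or_pos m with rfl | hm
      · rw [hzm, hz0]; linarith
      · rw [hzk 0 hm, hz0]; exact (abs_lt.1 (hyM 0 hm)).2
    · obtain ⟨l, rfl⟩ : ∃ l, k = l + 1 := ⟨k - 1, by omega⟩
      rw [hzk l (by omega)]
      rcases (Nat.lt_succ_iff.1 hk).eq_or_lt with h | h
      · rw [h, hzm]; exact (abs_lt.1 (hyM l (by omega))).1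
      · rw [hzk (l + 1) h]; exact hy _ _ (by omega) h
  have hzsign : ∀ k ≤ P.natDegree, 0 < (-1) ^ k * P.eval (z k) := by
    intro k hk
    rcases Nat.eq_zero_or_pos k with rfl | hk0
    · simpa [hz0] using hM1
    · obtain ⟨l, rfl⟩ : ∃ l, k = l + 1 := ⟨k - 1, by omega⟩
      by_cases hl : l < m
      · rw [hzk l hl]; exact hsign l hl
      · have : P.natDegree = m + 1 := by omega
        have : l = m := by omega
        subst this
        rw [hzm, ← this]; rw [‹P.natDegree = _›] at hM2 ⊢; exact hM2
  have hroot : ∀ k, ∃ x, k < P.natDegree → P.IsRoot x ∧ z (k + 1) < x ∧ x < z k := by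
    intro k
    by_cases hk : k < P.natDegree
    · have s1 := hzsign k hk.le
      have s2 := hzsign (k + 1) hk
      have hlt := hzlt k (by omega)
      have hc : ContinuousOn (fun x => (-1) ^ k * P.eval x) (Set.Icc (z (k + 1)) (z k)) := by
        fun_prop
      have := intermediate_value_Ioo hlt.le hc (show (0 : ℝ) ∈ _ from ⟨by
        rw [pow_succ] at s2; linarith, s1⟩)
      obtain ⟨x, hx, hx0⟩ := this
      refine ⟨x, fun _ => ⟨?_, hx.1, hx.2⟩⟩
      simpa using hx0
    · exact ⟨0, fun h => absurd h hk⟩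
  choose α hα using hroot
  have hanti : ∀ i j, i < j → j < P.natDegree → α j < α i := by
    have hzz : ∀ i j, i ≤ j → j ≤ m + 1 → z j ≤ z i := by
      intro i j hij
      induction j, hij using Nat.le_induction with
      | base => intro _; exact le_rfl
      | succ j hij ih => intro hj; exact (hzlt j (by omega)).le.trans (ih (by omega))
    intro i j hij hj
    have := hzz (i + 1) j hij (by omega)
    linarith [(hα j hj).2.2, (hα i (by omega)).2.1]
  have hP0 : P ≠ 0 := fun h => by simp [h] at hlead
  obtain ⟨hcard, hdesc⟩ := desc_image hanti
  have hsub : (Finset.range P.natDegree).image α ⊆ zeroSet P := by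
    intro x hx
    obtain ⟨k, hk, rfl⟩ := Finset.mem_image.1 hx
    exact Multiset.mem_toFinset.2
      ((mem_roots hP0).2 (hα k (Finset.mem_range.1 hk)).1)
  have hle : (zeroSet P).card ≤ P.natDegree :=
    (Multiset.toFinset_card_le _).trans (card_roots' P)
  have heq := Finset.eq_of_subset_of_card_le hsub (by rw [hcard]; exact hle)
  rw [heq] at hcard hdesc
  refine ⟨⟨hlead, hcard⟩, fun k hk => ?_, fun k hk hk' => ?_⟩
  · rw [hdesc k (by omega), ← hzk k hk]; exact (hα k (by omega)).2.1
  · rw [hdesc _ hk', ← hzk k hk]; exact (hα _ hk').2.2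

/-! ### The recurrence -/

/-- The sequence `W` of polynomials with positive parameters `a, b, t`, in the form of a recurrence
without subtraction of indices. -/
structure IsRecSeq (a b c t r : ℝ) (W : ℕ → ℝ[X]) : Prop where
  ha : 0 < a
  hb : 0 < b
  ht : 0 < t
  zero : W 0 = 1
  one : W 1 = C t * (X - C r)
  step : ∀ n, W (n + 2) = C a * W (n + 1) + (C b * X + C c) * W n

/-- The point `x < x*` at which the characteristic roots of the recurrence are `ρ exp (± i θ)`
with `ρ = a / (2 cos θ)`. -/
noncomputable def node (a b c θ : ℝ) : ℝ := -(c + (a / (2 * Real.cos θ)) ^ 2) / b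

/-- The `k`-th largest zero of `W n`, counting from `k = 0`. -/
noncomputable abbrev descRoot (W : ℕ → ℝ[X]) (n k : ℕ) : ℝ := desc (zeroSet (W n)) k

/-- The value of `W 1` minus the smaller characteristic root `a / 2 - √(b (x - x*))`, at a point
`x ≥ x*`. -/
noncomputable def gap (a b c t r x : ℝ) : ℝ := t * (x - r) - a / 2 + √(b * (x - xStar a b c))

namespace IsRecSeq

variable {a b c t r : ℝ} {W : ℕ → ℝ[X]}

theorem eval_zero (h : IsRecSeq a b c t r W) (x : ℝ) : (W 0).eval x = 1 := by simp [h.zero]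

theorem eval_one (h : IsRecSeq a b c t r W) (x : ℝ) : (W 1).eval x = t * (x - r) := by
  simp [h.one]

theorem eval_rec (h : IsRecSeq a b c t r W) (n : ℕ) (x : ℝ) :
    (W (n + 2)).eval x = a * (W (n + 1)).eval x + (b * x + c) * (W n).eval x := by
  simp [h.step]

theorem degree_aux (h : IsRecSeq a b c t r W) (n : ℕ) :
    (W n).natDegree ≤ (n + 1) / 2 ∧ 0 < (W n).coeff ((n + 1) / 2) := by
  induction n using Nat.twoStepInduction with
  | zero => simp [h.zero]
  | one =>
    rw [h.one]
    refine ⟨by compute_degree, ?_⟩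
    simpa [coeff_X] using h.ht
  | more n ih0 ih1 =>
    have e : (n + 2 + 1) / 2 = (n + 1) / 2 + 1 := by omega
    rw [e, h.step]
    constructor
    · refine natDegree_add_le_of_degree_le ?_ ?_
      · exact (natDegree_C_mul_le _ _).trans (ih1.1.trans (by omega))
      · refine natDegree_mul_le.trans ?_
        have : (C b * X + C c).natDegree ≤ 1 := natDegree_linear_le
        have := ih0.1
        omega
    · have h1 : 0 ≤ (W (n + 1)).coeff ((n + 1) / 2 + 1) := by
        by_cases hn : (n + 1 + 1) / 2 = (n + 1) / 2 + 1
        · rw [← hn]; exact ih1.2.le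
        · rw [coeff_eq_zero_of_natDegree_lt (ih1.1.trans_lt (by omega))]
      have h2 : (W n).coeff ((n + 1) / 2 + 1) = 0 :=
        coeff_eq_zero_of_natDegree_lt (ih0.1.trans_lt (by omega))
      rw [add_mul, mul_assoc, coeff_add, coeff_add, coeff_C_mul, coeff_C_mul, coeff_C_mul,
        coeff_X_mul, h2]
      have := mul_nonneg h.ha.le h1
      have := mul_pos h.hb ih0.2
      linarith

theorem natDegree_eq (h : IsRecSeq a b c t r W) (n : ℕ) : (W n).natDegree = (n + 1) / 2 :=
  le_antisymm (h.degree_aux n).1 (le_natDegree_of_ne_zero (h.degree_aux n).2.ne')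

theorem leadingCoeff_pos (h : IsRecSeq a b c t r W) (n : ℕ) : 0 < (W n).leadingCoeff := by
  rw [leadingCoeff, h.natDegree_eq]
  exact (h.degree_aux n).2

/-! ### Oscillation to the left of `x*` -/

theorem node_spec (h : IsRecSeq a b c t r W) (θ : ℝ) :
    b * node a b c θ + c = -(a / (2 * Real.cos θ)) ^ 2 := by
  have := h.hb.ne'
  rw [node]
  field_simp
  ring

theorem eval_node_mul_sin (h : IsRecSeq a b c t r W) {θ : ℝ} (hθ : 0 < Real.cos θ) (n : ℕ) :
    (W (n + 1)).eval (node a b c θ) * Real.sin θ = (a / (2 * Real.cos θ)) ^ n *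
      ((W 1).eval (node a b c θ) * Real.sin ((n + 1) * θ) -
        a / (2 * Real.cos θ) * Real.sin (n * θ)) := by
  have hs := h.node_spec θ
  have hρ : a = 2 * (a / (2 * Real.cos θ)) * Real.cos θ := by field_simp
  generalize a / (2 * Real.cos θ) = ρ at *
  generalize node a b c θ = x at *
  induction n using Nat.twoStepInduction with
  | zero => simp
  | one =>
    rw [h.eval_rec, hs, h.eval_zero]
    norm_num
    rw [Real.sin_two_mul]
    conv_lhs => rw [hρ]
    ring
  | more n ih0 ih1 =>
    have key : ∀ y : ℝ, Real.sin (y + θ + θ) =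
        2 * Real.cos θ * Real.sin (y + θ) - Real.sin y := by
      intro y
      rw [Real.sin_add (y + θ), Real.cos_add, Real.sin_add]
      linear_combination -Real.sin y * Real.sin_sq_add_cos_sq θ
    rw [h.eval_rec, hs, add_mul, mul_assoc, mul_assoc, ih0, ih1]
    push_cast
    rw [show ((n : ℝ) + 2 + 1) * θ = (n + 1) * θ + θ + θ by ring,
      show ((n : ℝ) + 2) * θ = n * θ + θ + θ by ring, key, key,
      show ((n : ℝ) + 1 + 1) * θ = (n + 1) * θ + θ by ring,
      show ((n : ℝ) + 1) * θ = n * θ + θ by ring]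
    conv_lhs => rw [hρ]
    ring

/-- At the angles `kπ / n` the value of `W n` does not depend on `W 1`, and alternates in sign. -/
theorem eval_node (h : IsRecSeq a b c t r W) {n k : ℕ} (hk : 0 < k) (hkn : 2 * k < n) :
    (W n).eval (node a b c (k * Real.pi / n)) =
      (-1) ^ k * (a / (2 * Real.cos (k * Real.pi / n))) ^ n := by
  obtain ⟨n, rfl⟩ : ∃ l, n = l + 1 := ⟨n - 1, by omega⟩
  have hn : (0 : ℝ) < (n + 1 : ℕ) := by positivity
  have hk' : (0 : ℝ) < k := by positivity
  set θ := k * Real.pi / (n + 1 : ℕ) with hθ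
  have h0 : 0 < θ := by positivity
  have h2 : θ < Real.pi / 2 := by
    rw [hθ, div_lt_div_iff₀ hn two_pos]
    have : (k : ℝ) * 2 < (n + 1 : ℕ) := by exact_mod_cast (by omega : k * 2 < n + 1)
    nlinarith [Real.pi_pos]
  have hcos : 0 < Real.cos θ := Real.cos_pos_of_mem_Ioo ⟨by linarith, h2⟩
  have hsin : 0 < Real.sin θ := Real.sin_pos_of_pos_of_lt_pi h0 (by linarith)
  have e1 : ((n : ℝ) + 1) * θ = k * Real.pi := by
    rw [hθ]; push_cast; field_simp
  have e2 : (n : ℝ) * θ = k * Real.pi - θ := by linarith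
  have := h.eval_node_mul_sin hcos n
  rw [e1, e2, Real.sin_sub, Real.sin_nat_mul_pi, Real.cos_nat_mul_pi] at this
  apply mul_right_cancel₀ hsin.ne'
  rw [this]
  ring

theorem node_lt_node (h : IsRecSeq a b c t r W) {θ φ : ℝ} (hθ : 0 ≤ θ) (hθφ : θ < φ)
    (hφ : φ < Real.pi / 2) : node a b c φ < node a b c θ := by
  have h1 : Real.cos φ < Real.cos θ :=
    Real.cos_lt_cos_of_nonneg_of_le_pi_div_two hθ hφ.le hθφ
  have h2 : 0 < Real.cos φ := Real.cos_pos_of_mem_Ioo ⟨by linarith [Real.pi_pos], hφ⟩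
  have := h.ha
  have := h.hb
  have := h2.trans h1
  rw [node, node]
  gcongr

theorem node_zero (h : IsRecSeq a b c t r W) : node a b c 0 = xStar a b c := by
  have := h.hb.ne'
  rw [node, xStar, Real.cos_zero]
  field_simp
  ring

/-- The zeros of `W n` are real and simple, and the nodes at the angles `kπ / n` separate them. -/
theorem localization (h : IsRecSeq a b c t r W) (n : ℕ) :
    SimpleRealRooted (W n) ∧ ∀ k, k + 1 < (n + 1) / 2 →
      node a b c ((k + 1 : ℕ) * Real.pi / n) < descRoot W n k ∧
        descRoot W n (k + 1) < node a b c ((k + 1 : ℕ) * Real.pi / n) := by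
  have hang : ∀ k, k < (n + 1) / 2 - 1 → ((k + 1 : ℕ) * Real.pi / n) < Real.pi / 2 := by
    intro k hk
    have hn : (0 : ℝ) < n := by exact_mod_cast (by omega : 0 < n)
    rw [div_lt_div_iff₀ hn two_pos]
    have : ((k + 1 : ℕ) : ℝ) * 2 < n := by exact_mod_cast (by omega : (k + 1) * 2 < n)
    nlinarith [Real.pi_pos]
  have := simpleRealRooted_of_alternating (P := W n) (m := (n + 1) / 2 - 1)
    (y := fun k => node a b c ((k + 1 : ℕ) * Real.pi / n)) (h.leadingCoeff_pos n)
    (by rw [h.natDegree_eq]; omega)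
    (fun i j hij hj => h.node_lt_node (by positivity) (by
      have hn : (0 : ℝ) < n := by exact_mod_cast (by omega : 0 < n)
      have := Real.pi_pos
      gcongr) (hang j hj))
    (fun k hk => by
      rw [h.eval_node (Nat.succ_pos k) (by omega), ← mul_assoc]
      have hc : 0 < Real.cos ((k + 1 : ℕ) * Real.pi / n) :=
        Real.cos_pos_of_mem_Ioo
          ⟨(neg_lt_zero.2 Real.pi_div_two_pos).trans_le (by positivity), hang k hk⟩
      have := h.ha
      rw [← pow_add, ← two_mul, pow_mul]
      positivity)
  refine ⟨this.1, fun k hk => ⟨this.2.1 k (by omega), this.2.2 k (by omega) ?_⟩⟩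
  rw [h.natDegree_eq]
  exact hk

theorem simpleRealRooted (h : IsRecSeq a b c t r W) (n : ℕ) : SimpleRealRooted (W n) :=
  (h.localization n).1

theorem card_zeroSet (h : IsRecSeq a b c t r W) (n : ℕ) : (zeroSet (W n)).card = (n + 1) / 2 := by
  rw [(h.simpleRealRooted n).2, h.natDegree_eq]

theorem descRoot_lt_descRoot (h : IsRecSeq a b c t r W) {n i j : ℕ} (hij : i < j)
    (hj : j < (n + 1) / 2) : descRoot W n j < descRoot W n i :=
  desc_lt_desc hij (by rwa [h.card_zeroSet])

theorem eval_descRoot (h : IsRecSeq a b c t r W) {n k : ℕ} (hk : k < (n + 1) / 2) :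
    (W n).eval (descRoot W n k) = 0 :=
  (h.simpleRealRooted n).eval_desc (by rwa [h.natDegree_eq])

theorem descRoot_lt_xStar (h : IsRecSeq a b c t r W) {n k : ℕ} (hk0 : 1 ≤ k)
    (hk : k < (n + 1) / 2) : descRoot W n k < xStar a b c := by
  obtain ⟨k, rfl⟩ : ∃ l, k = l + 1 := ⟨k - 1, by omega⟩
  have hn : (0 : ℝ) < n := by exact_mod_cast (by omega : 0 < n)
  refine (((h.localization n).2 k hk).2).trans ?_
  rw [← h.node_zero]
  apply h.node_lt_node le_rfl (by positivity)
  rw [div_lt_div_iff₀ hn two_pos]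
  have : ((k + 1 : ℕ) : ℝ) * 2 < n := by exact_mod_cast (by omega : (k + 1) * 2 < n)
  nlinarith [Real.pi_pos]

theorem xStar_lt (h : IsRecSeq a b c t r W) : xStar a b c < -c / b := by
  have := h.hb
  have := pow_pos h.ha 2
  rw [xStar, div_lt_div_iff₀ (by positivity) h.hb]
  nlinarith

theorem tendsto_node_zero (h : IsRecSeq a b c t r W) (k : ℕ) :
    Tendsto (fun n : ℕ => node a b c (k * Real.pi / n)) atTop (𝓝 (xStar a b c)) := by
  rw [← h.node_zero]
  have h1 : Tendsto (fun n : ℕ => k * Real.pi / (n : ℝ)) atTop (𝓝 0) :=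
    tendsto_const_nhds.div_atTop tendsto_natCast_atTop_atTop
  have h2 : ContinuousAt (node a b c) 0 := by
    unfold node
    refine ContinuousAt.div_const (ContinuousAt.neg (continuousAt_const.add
      (ContinuousAt.pow (continuousAt_const.div (by fun_prop) (by simp)) 2))) _
  exact h2.tendsto.comp h1

theorem tendsto_node_atBot (h : IsRecSeq a b c t r W) {θ : ℕ → ℝ}
    (hθ : Tendsto θ atTop (𝓝[<] (Real.pi / 2))) :
    Tendsto (fun n => node a b c (θ n)) atTop atBot := by
  have h1 : Tendsto (fun n => (2 * Real.cos (θ n))⁻¹) atTop atTop := by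
    have h2 := Real.tendsto_cos_pi_div_two.comp hθ
    refine tendsto_inv_nhdsGT_zero.comp (tendsto_nhdsWithin_iff.2 ⟨?_, ?_⟩)
    · simpa using (tendsto_nhds_of_tendsto_nhdsWithin h2).const_mul 2
    · filter_upwards [(tendsto_nhdsWithin_iff.1 h2).2] with n hn
      exact mul_pos two_pos (Set.mem_Ioi.1 hn)
  have h2 : Tendsto (fun n => (a / (2 * Real.cos (θ n))) ^ 2) atTop atTop :=
    (tendsto_pow_atTop two_ne_zero).comp (h1.const_mul_atTop h.ha)
  exact (tendsto_neg_atTop_atBot.comp (tendsto_atTop_add_const_left _ c h2)).atBot_div_const h.hb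

/-- All but the largest zeros, counted from the top, tend to `x*`. -/
theorem tendsto_descRoot (h : IsRecSeq a b c t r W) {i : ℕ} (hi : 1 ≤ i) :
    Tendsto (fun n => descRoot W n i) atTop (𝓝 (xStar a b c)) := by
  refine tendsto_of_tendsto_of_tendsto_of_le_of_le' (h.tendsto_node_zero (i + 1))
    (tendsto_const_nhds) ?_ ?_
  · filter_upwards [eventually_ge_atTop (2 * i + 4)] with n hn
    exact ((h.localization n).2 i (by omega)).1.le
  · filter_upwards [eventually_ge_atTop (2 * i + 4)] with n hn
    exact (h.descRoot_lt_xStar hi (by omega)).le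

/-- The zeros of fixed index counted from below tend to `-∞`. -/
theorem tendsto_descRoot_atBot (h : IsRecSeq a b c t r W) {i : ℕ} (hi : 1 ≤ i) :
    Tendsto (fun n => descRoot W n ((n + 1) / 2 - i)) atTop atBot := by
  have key : Tendsto (fun n : ℕ => (((n + 1) / 2 - i : ℕ) : ℝ) * Real.pi / n) atTop
      (𝓝[<] (Real.pi / 2)) := by
    rw [tendsto_nhdsWithin_iff]
    have hlt : ∀ᶠ n : ℕ in atTop, (((n + 1) / 2 - i : ℕ) : ℝ) * Real.pi / n < Real.pi / 2 := by
      filter_upwards [eventually_ge_atTop (2 * i + 4)] with n hn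
      have hn0 : (0 : ℝ) < n := by exact_mod_cast (by omega : 0 < n)
      rw [div_lt_div_iff₀ hn0 two_pos]
      have : (((n + 1) / 2 - i : ℕ) : ℝ) * 2 < n := by
        exact_mod_cast (by omega : ((n + 1) / 2 - i) * 2 < n)
      nlinarith [Real.pi_pos]
    refine ⟨?_, hlt⟩
    have hlim : Tendsto (fun n : ℕ => Real.pi / 2 - i * Real.pi / n) atTop (𝓝 (Real.pi / 2)) := by
      simpa using (tendsto_const_nhds (x := Real.pi / 2)).sub
        (tendsto_const_nhds (x := i * Real.pi) |>.div_atTop tendsto_natCast_atTop_atTop)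
    refine tendsto_of_tendsto_of_tendsto_of_le_of_le' hlim tendsto_const_nhds ?_
      (hlt.mono fun _ => le_of_lt)
    filter_upwards [eventually_ge_atTop (2 * i + 4)] with n hn
    have hn0 : (0 : ℝ) < n := by exact_mod_cast (by omega : 0 < n)
    have h1 : (n : ℝ) ≤ 2 * (((n + 1) / 2 - i : ℕ) : ℝ) + 2 * i := by
      exact_mod_cast (by omega : n ≤ 2 * ((n + 1) / 2 - i) + 2 * i)
    rw [sub_le_iff_le_add, ← add_div, div_le_div_iff₀ two_pos hn0]
    nlinarith [Real.pi_pos]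
  refine tendsto_atBot_mono' _ ?_ (h.tendsto_node_atBot key)
  filter_upwards [eventually_ge_atTop (2 * i + 4)] with n hn
  obtain ⟨l, hl⟩ : ∃ l, (n + 1) / 2 - i = l + 1 := ⟨(n + 1) / 2 - i - 1, by omega⟩
  rw [hl]
  exact ((h.localization n).2 l (by omega)).2.le

/-! ### Interlacing -/

theorem mul_add_neg (h : IsRecSeq a b c t r W) {x : ℝ} (hx : x < -c / b) : b * x + c < 0 := by
  rw [lt_div_iff₀ h.hb] at hx
  linarith

theorem mul_add_pos (h : IsRecSeq a b c t r W) {x : ℝ} (hx : -c / b < x) : 0 < b * x + c := by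
  rw [div_lt_iff₀ h.hb] at hx
  linarith

/-- At a zero of `W (n + 1)`, the recurrence relates `W (n + 2)` to `W n` directly. -/
theorem eval_descRoot_succ (h : IsRecSeq a b c t r W) {n k : ℕ} (hk : k < (n + 2) / 2) :
    (W (n + 2)).eval (descRoot W (n + 1) k) =
      (b * descRoot W (n + 1) k + c) * (W n).eval (descRoot W (n + 1) k) := by
  rw [h.eval_rec, h.eval_descRoot hk]
  ring

/-- At a zero of `W n`, the signs of `W (n + 2)` and `W (n + 1)` agree. -/
theorem eval_add_two_descRoot (h : IsRecSeq a b c t r W) {n k : ℕ} (hk : k < (n + 1) / 2) :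
    (W (n + 2)).eval (descRoot W n k) = a * (W (n + 1)).eval (descRoot W n k) := by
  rw [h.eval_rec, h.eval_descRoot hk]
  ring

/-- If exactly `k` zeros of `W n` lie above the `k`-th zero of `W (n + 1)`, and the latter is left
of `-c / b`, then the sign of `W (n + 2)` there is determined. -/
theorem sign_eval_succ (h : IsRecSeq a b c t r W) {n k : ℕ} (hk : k < (n + 2) / 2)
    (hx : descRoot W (n + 1) k < -c / b)
    (h1 : ∀ i < k, descRoot W (n + 1) k < descRoot W n i)
    (h2 : k < (n + 1) / 2 → descRoot W n k < descRoot W (n + 1) k) :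
    0 < (-1) ^ (k + 1) * (W (n + 2)).eval (descRoot W (n + 1) k) := by
  rw [h.eval_descRoot_succ hk]
  have := (h.simpleRealRooted n).sign_eval (j := k) (by rw [h.natDegree_eq]; omega) h1
    (by rwa [h.natDegree_eq])
  have := mul_pos (neg_pos.2 (h.mul_add_neg hx)) this
  rw [pow_succ]
  linarith

theorem eval_neg_div (h : IsRecSeq a b c t r W) (n : ℕ) :
    (W (n + 1)).eval (-c / b) = a ^ n * (t * (-c / b - r)) := by
  have h0 : b * (-c / b) + c = 0 := by
    have := h.hb.ne'
    field_simp
    ring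
  induction n with
  | zero => rw [h.eval_one]; ring
  | succ n ih => rw [h.eval_rec, h0, ih]; ring

theorem descRoot_lt_of_lt (h : IsRecSeq a b c t r W) (hr : r < -c / b) {n k : ℕ}
    (hk : k < (n + 1) / 2) : descRoot W n k < -c / b := by
  by_contra! hx
  have key : ∀ x, -c / b ≤ x → ∀ n, 0 < (W n).eval x ∧ 0 < (W (n + 1)).eval x := by
    intro x hx n
    induction n with
    | zero =>
      rw [h.eval_zero, h.eval_one]
      exact ⟨one_pos, mul_pos h.ht (by linarith)⟩
    | succ n ih =>
      refine ⟨ih.2, ?_⟩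
      rw [h.eval_rec]
      rw [div_le_iff₀ h.hb] at hx
      have := mul_pos h.ha ih.2
      have := mul_nonneg (show 0 ≤ b * x + c by linarith) ih.1.le
      linarith
  exact (key _ hx n).1.ne' (h.eval_descRoot hk)

/-- Consequence of a sign alternation of `W m` at the zeros of `W n`. -/
theorem interlace_of_sign (h : IsRecSeq a b c t r W) {m n : ℕ}
    (hd : (m + 1) / 2 = (n + 1) / 2 ∨ (m + 1) / 2 = (n + 1) / 2 + 1)
    (hs : ∀ k < (n + 1) / 2, 0 < (-1) ^ (k + 1) * (W m).eval (descRoot W n k)) :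
    (∀ k < (n + 1) / 2, descRoot W n k < descRoot W m k) ∧
      ∀ k < (n + 1) / 2, k + 1 < (m + 1) / 2 → descRoot W m (k + 1) < descRoot W n k := by
  have := simpleRealRooted_of_alternating (h.leadingCoeff_pos m) (m := (n + 1) / 2)
    (by rw [h.natDegree_eq]; exact hd) (fun i j hij hj => h.descRoot_lt_descRoot hij hj) hs
  rw [h.natDegree_eq] at this
  exact this.2

/-- For `r < -c / b`, the polynomial `W (n + 1)` alternates in sign along the zeros of `W n`. -/
theorem sign_eval_of_lt (h : IsRecSeq a b c t r W) (hr : r < -c / b) (n : ℕ) :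
    ∀ k < (n + 2) / 2, 0 < (-1) ^ (k + 1) * (W (n + 2)).eval (descRoot W (n + 1) k) := by
  induction n with
  | zero =>
    intro k hk
    exact h.sign_eval_succ hk (h.descRoot_lt_of_lt hr hk) (by omega) (by omega)
  | succ n ih =>
    obtain ⟨i1, i2⟩ := h.interlace_of_sign (m := n + 2) (n := n + 1) (by omega) ih
    intro k hk
    refine h.sign_eval_succ hk (h.descRoot_lt_of_lt hr hk) (fun i hi => ?_) (i1 k)
    exact (desc_le_desc (S := zeroSet (W (n + 2))) hi (by rw [h.card_zeroSet]; omega)).trans_lt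
      (i2 i (by omega) (by omega))

theorem interlace_succ_of_lt (h : IsRecSeq a b c t r W) (hr : r < -c / b) {n : ℕ} (hn : 1 ≤ n) :
    (∀ k < (n + 1) / 2, descRoot W n k < descRoot W (n + 1) k) ∧
      ∀ k < (n + 1) / 2, k + 1 < (n + 1 + 1) / 2 →
        descRoot W (n + 1) (k + 1) < descRoot W n k := by
  obtain ⟨n, rfl⟩ : ∃ l, n = l + 1 := ⟨n - 1, by omega⟩
  exact h.interlace_of_sign (by omega) (h.sign_eval_of_lt hr n)

theorem interlace_add_two_of_lt (h : IsRecSeq a b c t r W) (hr : r < -c / b) {n : ℕ}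
    (hn : 1 ≤ n) :
    (∀ k < (n + 1) / 2, descRoot W n k < descRoot W (n + 2) k) ∧
      ∀ k < (n + 1) / 2, k + 1 < (n + 2 + 1) / 2 →
        descRoot W (n + 2) (k + 1) < descRoot W n k := by
  obtain ⟨n, rfl⟩ : ∃ l, n = l + 1 := ⟨n - 1, by omega⟩
  refine h.interlace_of_sign (by omega) fun k hk => ?_
  rw [h.eval_add_two_descRoot hk]
  have := mul_pos h.ha (h.sign_eval_of_lt hr n k hk)
  linarith

theorem eval_neg_div_neg (h : IsRecSeq a b c t r W) (hr : -c / b < r) {n : ℕ} (hn : 1 ≤ n) :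
    (W n).eval (-c / b) < 0 := by
  obtain ⟨n, rfl⟩ : ∃ l, n = l + 1 := ⟨n - 1, by omega⟩
  rw [h.eval_neg_div]
  exact mul_neg_of_pos_of_neg (pow_pos h.ha n) (mul_neg_of_pos_of_neg h.ht (by linarith))

theorem neg_div_lt_descRoot (h : IsRecSeq a b c t r W) (hr : -c / b < r) {n : ℕ} (hn : 1 ≤ n) :
    -c / b < descRoot W n 0 :=
  (h.simpleRealRooted n).lt_desc_zero_of_eval_neg (by rw [h.natDegree_eq]; omega)
    (h.eval_neg_div_neg hr hn)

theorem descRoot_lt_neg_div (h : IsRecSeq a b c t r W) {n k : ℕ} (hk0 : 1 ≤ k)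
    (hk : k < (n + 1) / 2) : descRoot W n k < -c / b :=
  (h.descRoot_lt_xStar hk0 hk).trans h.xStar_lt

/-- Analogue of `interlace_of_sign` for `r > -c / b`: the largest zero of `W n` is replaced by the
point `-c / b`, at which `W m` is negative. -/
theorem interlace_of_sign_of_gt (h : IsRecSeq a b c t r W) (hr : -c / b < r) {m n : ℕ}
    (hm : 1 ≤ m) (hd : (m + 1) / 2 = (n + 1) / 2 ∨ (m + 1) / 2 = (n + 1) / 2 + 1)
    (hs : ∀ k, 1 ≤ k → k < (n + 1) / 2 →
      0 < (-1) ^ (k + 1) * (W m).eval (descRoot W n k)) :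
    (∀ k, 1 ≤ k → k < (n + 1) / 2 → descRoot W n k < descRoot W m k) ∧
      ∀ k, 1 ≤ k → k < (n + 1) / 2 → k + 1 < (m + 1) / 2 →
        descRoot W m (k + 1) < descRoot W n k := by
  have := simpleRealRooted_of_alternating (h.leadingCoeff_pos m) (m := (n + 1) / 2)
    (y := fun k => if k = 0 then -c / b else descRoot W n k)
    (by rw [h.natDegree_eq]; exact hd)
    (fun i j hij hj => by
      rw [if_neg (show j ≠ 0 by omega)]
      split_ifs with hi
      · exact h.descRoot_lt_neg_div (by omega) hj
      · exact h.descRoot_lt_descRoot hij hj)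
    (fun k hk => by
      split_ifs with hk0
      · simpa [hk0] using h.eval_neg_div_neg hr hm
      · exact hs k (by omega) hk)
  rw [h.natDegree_eq] at this
  constructor
  · intro k hk0 hk
    simpa [show k ≠ 0 by omega] using this.2.1 k hk
  · intro k hk0 hk hk'
    simpa [show k ≠ 0 by omega] using this.2.2 k hk hk'

theorem sign_eval_of_gt (h : IsRecSeq a b c t r W) (hr : -c / b < r) (n : ℕ) :
    ∀ k, 1 ≤ k → k < (n + 2) / 2 →
      0 < (-1) ^ (k + 1) * (W (n + 2)).eval (descRoot W (n + 1) k) := by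
  induction n with
  | zero => omega
  | succ n ih =>
    obtain ⟨i1, i2⟩ := h.interlace_of_sign_of_gt hr (m := n + 2) (n := n + 1) (by omega)
      (by omega) ih
    intro k hk0 hk
    have hx := h.descRoot_lt_neg_div (n := n + 1 + 1) hk0 hk
    refine h.sign_eval_succ hk hx (fun i hi => ?_) (i1 k hk0)
    rcases Nat.eq_zero_or_pos i with rfl | hi0
    · exact hx.trans (h.neg_div_lt_descRoot hr (by omega))
    · exact (desc_le_desc (S := zeroSet (W (n + 2))) hi
        (by rw [h.card_zeroSet]; omega)).trans_lt (i2 i hi0 (by omega) (by omega))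

theorem interlace_succ_of_gt (h : IsRecSeq a b c t r W) (hr : -c / b < r) {n : ℕ} (hn : 1 ≤ n) :
    (∀ k, 1 ≤ k → k < (n + 1) / 2 → descRoot W n k < descRoot W (n + 1) k) ∧
      ∀ k, 1 ≤ k → k < (n + 1) / 2 → k + 1 < (n + 1 + 1) / 2 →
        descRoot W (n + 1) (k + 1) < descRoot W n k := by
  obtain ⟨n, rfl⟩ : ∃ l, n = l + 1 := ⟨n - 1, by omega⟩
  exact h.interlace_of_sign_of_gt hr (by omega) (by omega) (h.sign_eval_of_gt hr n)

theorem interlace_add_two_of_gt (h : IsRecSeq a b c t r W) (hr : -c / b < r) {n : ℕ}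
    (hn : 1 ≤ n) :
    (∀ k, 1 ≤ k → k < (n + 1) / 2 → descRoot W n k < descRoot W (n + 2) k) ∧
      ∀ k, 1 ≤ k → k < (n + 1) / 2 → k + 1 < (n + 2 + 1) / 2 →
        descRoot W (n + 2) (k + 1) < descRoot W n k := by
  obtain ⟨n, rfl⟩ : ∃ l, n = l + 1 := ⟨n - 1, by omega⟩
  refine h.interlace_of_sign_of_gt hr (by omega) (by omega) fun k hk0 hk => ?_
  rw [h.eval_add_two_descRoot hk]
  have := mul_pos h.ha (h.sign_eval_of_gt hr n k hk0 hk)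
  linarith

/-! ### The largest zero -/

theorem descRoot_zero_lt_xStar (h : IsRecSeq a b c t r W) (hr : r ≤ rStar a b c t) {n : ℕ}
    (hn : 1 ≤ n) : descRoot W n 0 < xStar a b c := by
  by_contra! hx
  set x := descRoot W n 0 with hxdef
  have hx' : -(a ^ 2 / 4) ≤ b * x + c := by
    have := mul_le_mul_of_nonneg_left hx h.hb.le
    have e : b * xStar a b c = -(a ^ 2 / 4) - c := by
      have := h.hb.ne'
      rw [xStar]
      field_simp
      ring
    linarith
  have h1 : a / 2 ≤ t * (x - r) := by
    have : a / (2 * t) ≤ x - r := by rw [rStar] at hr; linarith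
    have := mul_le_mul_of_nonneg_left this h.ht.le
    have e : t * (a / (2 * t)) = a / 2 := by
      have := h.ht.ne'
      field_simp
    linarith
  -- The ratio of consecutive values never drops below the double characteristic root at `x*`.
  have key : ∀ n, 0 < (W n).eval x ∧ a / 2 * (W n).eval x ≤ (W (n + 1)).eval x := by
    intro n
    induction n with
    | zero =>
      rw [h.eval_zero, h.eval_one]
      exact ⟨one_pos, by linarith⟩
    | succ n ih =>
      have ha := h.ha
      refine ⟨(mul_pos (half_pos ha) ih.1).trans_le ih.2, ?_⟩
      rw [h.eval_rec]
      have := mul_le_mul_of_nonneg_right hx' ih.1.le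
      have := mul_le_mul_of_nonneg_left ih.2 (half_pos ha).le
      nlinarith
  exact (key n).1.ne' (h.eval_descRoot (by omega))

theorem tendsto_descRoot_zero_of_le (h : IsRecSeq a b c t r W) (hr : r ≤ rStar a b c t) :
    Tendsto (fun n => descRoot W n 0) atTop (𝓝 (xStar a b c)) := by
  refine tendsto_of_tendsto_of_tendsto_of_le_of_le' (h.tendsto_node_zero 1)
    (tendsto_const_nhds) ?_ ?_
  · filter_upwards [eventually_ge_atTop 4] with n hn
    exact ((h.localization n).2 0 (by omega)).1.le
  · filter_upwards [eventually_ge_atTop 1] with n hn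
    exact (h.descRoot_zero_lt_xStar hr hn).le

/-- Binet's formula to the right of `x*`, where the characteristic roots are real. -/
theorem binet (h : IsRecSeq a b c t r W) {x : ℝ} (hx : xStar a b c ≤ x) (n : ℕ) :
    2 * √(b * (x - xStar a b c)) * (W n).eval x =
      gap a b c t r x * (a / 2 + √(b * (x - xStar a b c))) ^ n +
        (2 * √(b * (x - xStar a b c)) - gap a b c t r x) *
          (a / 2 - √(b * (x - xStar a b c))) ^ n := by
  have hsq : √(b * (x - xStar a b c)) ^ 2 = b * x + c + a ^ 2 / 4 := by
    rw [Real.sq_sqrt (mul_nonneg h.hb.le (sub_nonneg.2 hx)), xStar]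
    have := h.hb.ne'
    field_simp
    ring
  have hg : gap a b c t r x = t * (x - r) - a / 2 + √(b * (x - xStar a b c)) := rfl
  rw [hg]
  generalize √(b * (x - xStar a b c)) = σ at *
  induction n using Nat.twoStepInduction with
  | zero => rw [h.eval_zero]; ring
  | one => rw [h.eval_one]; ring
  | more n ih0 ih1 =>
    rw [h.eval_rec, show b * x + c = σ ^ 2 - a ^ 2 / 4 by linarith]
    linear_combination a * ih1 + (σ ^ 2 - a ^ 2 / 4) * ih0

theorem tendsto_eval_div (h : IsRecSeq a b c t r W) {x : ℝ} (hx : xStar a b c < x) :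
    Tendsto (fun n => 2 * √(b * (x - xStar a b c)) * (W n).eval x /
      (a / 2 + √(b * (x - xStar a b c))) ^ n) atTop (𝓝 (gap a b c t r x)) := by
  have hσ : 0 < √(b * (x - xStar a b c)) := Real.sqrt_pos.2 (mul_pos h.hb (sub_pos.2 hx))
  have hb := h.binet hx.le
  have ha := h.ha
  generalize √(b * (x - xStar a b c)) = σ at *
  have hq : Tendsto (fun n => gap a b c t r x + (2 * σ - gap a b c t r x) *
      ((a / 2 - σ) / (a / 2 + σ)) ^ n) atTop
        (𝓝 (gap a b c t r x + (2 * σ - gap a b c t r x) * 0)) := by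
    refine tendsto_const_nhds.add ((tendsto_pow_atTop_nhds_zero_of_abs_lt_one ?_).const_mul _)
    rw [abs_lt, lt_div_iff₀ (by positivity), div_lt_iff₀ (by positivity)]
    constructor <;> linarith
  rw [mul_zero, add_zero] at hq
  refine hq.congr fun n => ?_
  rw [hb, div_pow]
  have : (a / 2 + σ) ^ n ≠ 0 := by positivity
  field_simp

theorem eventually_eval_neg (h : IsRecSeq a b c t r W) {x : ℝ} (hx : xStar a b c < x)
    (hg : gap a b c t r x < 0) : ∀ᶠ n in atTop, (W n).eval x < 0 := by
  have hσ : 0 < √(b * (x - xStar a b c)) := Real.sqrt_pos.2 (mul_pos h.hb (sub_pos.2 hx))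
  have ha := h.ha
  filter_upwards [(h.tendsto_eval_div hx).eventually_lt_const hg] with n hn
  rw [div_lt_iff₀ (by positivity), zero_mul] at hn
  exact (pos_iff_neg_of_mul_neg hn).1 (by positivity)

theorem eventually_eval_pos (h : IsRecSeq a b c t r W) {x : ℝ} (hx : xStar a b c < x)
    (hg : 0 < gap a b c t r x) : ∀ᶠ n in atTop, 0 < (W n).eval x := by
  have hσ : 0 < √(b * (x - xStar a b c)) := Real.sqrt_pos.2 (mul_pos h.hb (sub_pos.2 hx))
  have ha := h.ha
  filter_upwards [(h.tendsto_eval_div hx).eventually_const_lt hg] with n hn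
  rw [lt_div_iff₀ (by positivity), zero_mul] at hn
  exact (pos_iff_pos_of_mul_pos hn).1 (by positivity)

theorem gap_lt_gap (h : IsRecSeq a b c t r W) {x y : ℝ} (hxy : x < y) :
    gap a b c t r x < gap a b c t r y := by
  have h1 : √(b * (x - xStar a b c)) ≤ √(b * (y - xStar a b c)) :=
    Real.sqrt_le_sqrt (mul_le_mul_of_nonneg_left (by linarith) h.hb.le)
  have h2 := mul_lt_mul_of_pos_left hxy h.ht
  rw [gap, gap]
  linarith

/-- At `y*` the value of `W 1` is the smaller characteristic root. -/
theorem yStar_spec (h : IsRecSeq a b c t r W) (hr : rStar a b c t < r) :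
    xStar a b c < yStar a b c t r ∧ gap a b c t r (yStar a b c t r) = 0 := by
  have ha := h.ha
  have hb := h.hb
  have ht := h.ht
  have hD : b ^ 2 < (a * t + b) ^ 2 + 4 * t ^ 2 * (b * r + c) := by
    have e : (a * t + b) ^ 2 + 4 * t ^ 2 * (b * r + c) - b ^ 2 =
        4 * t ^ 2 * b * (r - rStar a b c t) := by
      rw [rStar, xStar]
      field_simp
      ring
    have : 0 < 4 * t ^ 2 * b * (r - rStar a b c t) :=
      mul_pos (by positivity) (sub_pos.2 hr)
    linarith
  have hs2 : √((a * t + b) ^ 2 + 4 * t ^ 2 * (b * r + c)) ^ 2 =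
      (a * t + b) ^ 2 + 4 * t ^ 2 * (b * r + c) := Real.sq_sqrt ((sq_nonneg b).trans hD.le)
  have hs : b < √((a * t + b) ^ 2 + 4 * t ^ 2 * (b * r + c)) := Real.lt_sqrt_of_sq_lt hD
  have hy : yStar a b c t r = r + ((a * t + b) -
    √((a * t + b) ^ 2 + 4 * t ^ 2 * (b * r + c))) / (2 * t ^ 2) := rfl
  generalize √((a * t + b) ^ 2 + 4 * t ^ 2 * (b * r + c)) = s at *
  have e1 : a / 2 - t * (yStar a b c t r - r) = (s - b) / (2 * t) := by
    rw [hy]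
    field_simp
    ring
  have e2 : b * (yStar a b c t r - xStar a b c) = ((s - b) / (2 * t)) ^ 2 := by
    rw [hy, xStar]
    field_simp
    linear_combination -4 * hs2
  have hpos : 0 < (s - b) / (2 * t) := div_pos (sub_pos.2 hs) (by positivity)
  constructor
  · have : 0 < b * (yStar a b c t r - xStar a b c) := by rw [e2]; positivity
    exact sub_pos.1 (pos_of_mul_pos_right this hb.le)
  · rw [gap, e2, Real.sqrt_sq hpos.le]
    linarith

/-- For `r > r*` the largest zero tends to `y*`: by Binet's formula `W n` is eventually negative
at each point just left of `y*`, and eventually positive at each point right of `y*`. -/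
theorem tendsto_descRoot_zero_of_gt (h : IsRecSeq a b c t r W) (hr : rStar a b c t < r) :
    Tendsto (fun n => descRoot W n 0) atTop (𝓝 (yStar a b c t r)) := by
  obtain ⟨hxy, hg⟩ := h.yStar_spec hr
  refine tendsto_order.2 ⟨fun u hu => ?_, fun u hu => ?_⟩
  · obtain ⟨x, hx1, hx2⟩ := exists_between (max_lt hu hxy)
    have hx := (le_max_right _ _).trans_lt hx1
    filter_upwards [eventually_ge_atTop 1,
      h.eventually_eval_neg hx (by rw [← hg]; exact h.gap_lt_gap hx2)] with n hn hneg
    exact ((le_max_left _ _).trans_lt hx1).trans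
      ((h.simpleRealRooted n).lt_desc_zero_of_eval_neg (by rw [h.natDegree_eq]; omega) hneg)
  · filter_upwards [eventually_ge_atTop 1, h.eventually_eval_pos (hxy.trans hu)
      (by rw [← hg]; exact h.gap_lt_gap hu)] with n hn hpos
    refine (h.simpleRealRooted n).desc_zero_lt_of_eval_pos (by rw [h.natDegree_eq]; omega) hpos
      fun hn' => ?_
    rw [h.natDegree_eq] at hn'
    exact (h.descRoot_lt_xStar le_rfl hn').trans (hxy.trans hu)

theorem rStar_lt_xStar (h : IsRecSeq a b c t r W) : rStar a b c t < xStar a b c := by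
  have := h.ha
  have := h.ht
  rw [rStar, sub_lt_self_iff]
  positivity

theorem descRoot_one_zero (h : IsRecSeq a b c t r W) : descRoot W 1 0 = r := by
  have := h.eval_descRoot (n := 1) (k := 0) (by norm_num)
  rw [h.eval_one] at this
  exact sub_eq_zero.1 ((mul_eq_zero.1 this).resolve_left h.ht.ne')

theorem descRoot_zero_lt_of_eval_pos (h : IsRecSeq a b c t r W) {n : ℕ} {x : ℝ} (hn : 1 ≤ n)
    (hx : -c / b < x) (hpos : 0 < (W n).eval x) : descRoot W n 0 < x :=
  (h.simpleRealRooted n).desc_zero_lt_of_eval_pos (by rw [h.natDegree_eq]; omega) hpos fun hn' =>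
    (h.descRoot_lt_neg_div le_rfl (by rwa [h.natDegree_eq] at hn')).trans hx

theorem lt_descRoot_zero_of_eval_neg (h : IsRecSeq a b c t r W) {n : ℕ} {x : ℝ} (hn : 1 ≤ n)
    (hneg : (W n).eval x < 0) : x < descRoot W n 0 :=
  (h.simpleRealRooted n).lt_desc_zero_of_eval_neg (by rw [h.natDegree_eq]; omega) hneg

/-- For `r > -c / b`, the largest zeros of consecutive polynomials lie alternately on both sides of
each other, as the factor `b x + c` of the recurrence is positive there. -/
theorem eval_descRoot_zero_alternating (h : IsRecSeq a b c t r W) (hr : -c / b < r) (j : ℕ) :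
    0 < (W (2 * j + 2)).eval (descRoot W (2 * j + 1) 0) ∧
      (W (2 * j + 3)).eval (descRoot W (2 * j + 2) 0) < 0 := by
  have hbase : 0 < (W 2).eval (descRoot W 1 0) := by
    rw [h.eval_descRoot_succ (by norm_num), h.eval_zero, mul_one]
    exact h.mul_add_pos (h.neg_div_lt_descRoot hr le_rfl)
  have step1 : ∀ n, 1 ≤ n → 0 < (W (n + 1)).eval (descRoot W n 0) →
      (W (n + 2)).eval (descRoot W (n + 1) 0) < 0 := by
    intro n hn hpos
    have hlt := h.descRoot_zero_lt_of_eval_pos (by omega) (h.neg_div_lt_descRoot hr hn) hpos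
    have hx := h.neg_div_lt_descRoot hr (n := n + 1) (by omega)
    rw [h.eval_descRoot_succ (by omega)]
    have := (h.simpleRealRooted n).sign_eval (j := 1) (x := descRoot W (n + 1) 0)
      (by rw [h.natDegree_eq]; omega) (fun i hi => by rw [Nat.lt_one_iff.1 hi]; exact hlt)
      (fun hn' => (h.descRoot_lt_neg_div le_rfl (by rwa [h.natDegree_eq] at hn')).trans hx)
    exact mul_neg_of_pos_of_neg (h.mul_add_pos hx) (by linarith)
  have step2 : ∀ n, 1 ≤ n → (W (n + 1)).eval (descRoot W n 0) < 0 →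
      0 < (W (n + 2)).eval (descRoot W (n + 1) 0) := by
    intro n hn hneg
    have hlt := h.lt_descRoot_zero_of_eval_neg (by omega) hneg
    have hx := h.neg_div_lt_descRoot hr (n := n + 1) (by omega)
    rw [h.eval_descRoot_succ (by omega)]
    have := (h.simpleRealRooted n).sign_eval (j := 0) (x := descRoot W (n + 1) 0)
      (Nat.zero_le _) (by omega) (fun _ => hlt)
    exact mul_pos (h.mul_add_pos hx) (by linarith)
  induction j with
  | zero => exact ⟨hbase, step1 1 le_rfl hbase⟩
  | succ j ih =>
    have := step2 (2 * j + 2) (by omega) ih.2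
    exact ⟨this, step1 (2 * j + 3) (by omega) this⟩

theorem descRoot_zero_even_lt (h : IsRecSeq a b c t r W) (hr : -c / b < r) {j : ℕ} (hj : 1 ≤ j) :
    descRoot W (2 * j) 0 < descRoot W (2 * (j + 1)) 0 := by
  obtain ⟨j, rfl⟩ : ∃ l, j = l + 1 := ⟨j - 1, by omega⟩
  refine h.lt_descRoot_zero_of_eval_neg (by omega) ?_
  rw [show 2 * (j + 1 + 1) = 2 * (j + 1) + 2 by ring, h.eval_add_two_descRoot (by omega)]
  exact mul_neg_of_pos_of_neg h.ha (h.eval_descRoot_zero_alternating hr j).2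

theorem descRoot_zero_odd_lt (h : IsRecSeq a b c t r W) (hr : -c / b < r) {j : ℕ} (hj : 1 ≤ j) :
    descRoot W (2 * (j + 1) - 1) 0 < descRoot W (2 * j - 1) 0 := by
  obtain ⟨j, rfl⟩ : ∃ l, j = l + 1 := ⟨j - 1, by omega⟩
  rw [show 2 * (j + 1 + 1) - 1 = 2 * j + 1 + 2 by omega, show 2 * (j + 1) - 1 = 2 * j + 1 by omega]
  refine h.descRoot_zero_lt_of_eval_pos (by omega) (h.neg_div_lt_descRoot hr (by omega)) ?_
  rw [h.eval_add_two_descRoot (by omega)]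
  exact mul_pos h.ha (h.eval_descRoot_zero_alternating hr j).1

end IsRecSeq

/-! ### Best bounds and monotone sequences -/

theorem isBestBound_Iio {S : Set ℝ} {u : ℝ} (h1 : ∀ x ∈ S, x < u) (h2 : ∀ z, ∃ x ∈ S, x < z)
    (h3 : ∀ z < u, ∃ x ∈ S, z < x) : IsBestBound S (Set.Iio u) := by
  refine ⟨⟨Set.ordConnected_Iio, h1⟩, fun J ⟨hJ, hSJ⟩ z hz => ?_⟩
  obtain ⟨x, hx, hxz⟩ := h2 z
  obtain ⟨y, hy, hzy⟩ := h3 z hz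
  exact hJ.out (hSJ hx) (hSJ hy) ⟨hxz.le, hzy.le⟩

theorem isBestBound_Iic {S : Set ℝ} {u : ℝ} (h1 : ∀ x ∈ S, x ≤ u) (h2 : ∀ z, ∃ x ∈ S, x < z)
    (hu : u ∈ S) : IsBestBound S (Set.Iic u) := by
  refine ⟨⟨Set.ordConnected_Iic, h1⟩, fun J ⟨hJ, hSJ⟩ z hz => ?_⟩
  obtain ⟨x, hx, hxz⟩ := h2 z
  exact hJ.out (hSJ hx) (hSJ hu) ⟨hxz.le, hz⟩

theorem strictMonoOn_Ici_of_lt_succ {u : ℕ → ℝ} {N : ℕ} (hu : ∀ n, N ≤ n → u n < u (n + 1)) :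
    StrictMonoOn u (Set.Ici N) :=
  strictMonoOn_of_lt_succ Set.ordConnected_Ici fun n _ hn _ => hu n hn

theorem strictAntiOn_Ici_of_succ_lt {u : ℕ → ℝ} {N : ℕ} (hu : ∀ n, N ≤ n → u (n + 1) < u n) :
    StrictAntiOn u (Set.Ici N) :=
  strictAntiOn_of_succ_lt Set.ordConnected_Ici fun n _ hn _ => hu n hn

theorem IncreasesTo.lt {u : ℕ → ℝ} {N : ℕ} {x : ℝ} (hu : IncreasesTo u N x) {n : ℕ} (hn : N ≤ n) :
    u n < x := by
  refine (hu.1 hn (hn.trans n.le_succ) n.lt_succ_self).trans_le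
    (ge_of_tendsto hu.2 ((eventually_ge_atTop (n + 1)).mono fun m hm => ?_))
  exact hu.1.monotoneOn (hn.trans n.le_succ) (hn.trans (n.le_succ.trans hm)) hm

theorem DecreasesTo.lt {u : ℕ → ℝ} {N : ℕ} {x : ℝ} (hu : DecreasesTo u N x) {n : ℕ} (hn : N ≤ n) :
    x < u n := by
  have : IncreasesTo (-u) N (-x) := ⟨hu.1.neg, hu.2.neg⟩
  simpa using this.lt hn

/-! ### Interlacing, monotonicity and best bounds of the zero sets -/

namespace IsRecSeq

variable {a b c t r : ℝ} {W : ℕ → ℝ[X]}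

theorem interlacesRight_of_lt (h : IsRecSeq a b c t r W) (hr : r < -c / b) {n : ℕ} (hn : 1 ≤ n) :
    InterlacesRight (zeroSet (W (n + 1))) (zeroSet (W n)) := by
  have := h.interlace_succ_of_lt hr hn
  apply interlacesRight_of_desc <;> simp only [h.card_zeroSet]
  · omega
  · omega
  · exact this.1
  · exact this.2

theorem interlacesBoth_of_lt (h : IsRecSeq a b c t r W) (hr : r < -c / b) {n : ℕ} (hn : 1 ≤ n) :
    InterlacesBoth (zeroSet (W (n + 2))) (zeroSet (W n)) := by
  have := h.interlace_add_two_of_lt hr hn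
  apply interlacesBoth_of_desc <;> simp only [h.card_zeroSet]
  · omega
  · exact fun k hk => ⟨this.1 k hk, this.2 k hk (by omega)⟩

theorem card_dropMax_zeroSet (h : IsRecSeq a b c t r W) {n : ℕ} (hn : 1 ≤ n) :
    (dropMax (zeroSet (W n))).card = (n + 1) / 2 - 1 := by
  rw [card_dropMax (by rw [h.card_zeroSet]; omega), h.card_zeroSet]

theorem desc_dropMax_zeroSet (h : IsRecSeq a b c t r W) {n k : ℕ} (hk : k + 1 < (n + 1) / 2) :
    desc (dropMax (zeroSet (W n))) k = descRoot W n (k + 1) :=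
  desc_dropMax (by rwa [h.card_zeroSet])

theorem interlacesRight_dropMax (h : IsRecSeq a b c t r W) (hr : -c / b < r) {n : ℕ}
    (hn : 3 ≤ n) :
    InterlacesRight (dropMax (zeroSet (W (n + 1)))) (dropMax (zeroSet (W n))) := by
  have := h.interlace_succ_of_gt hr (n := n) (by omega)
  apply interlacesRight_of_desc <;>
    simp only [h.card_dropMax_zeroSet (show 1 ≤ n by omega),
      h.card_dropMax_zeroSet (show 1 ≤ n + 1 by omega)]
  · omega
  · omega
  · intro k hk
    rw [h.desc_dropMax_zeroSet (by omega), h.desc_dropMax_zeroSet (by omega)]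
    exact this.1 _ (by omega) (by omega)
  · intro k hk hk'
    rw [h.desc_dropMax_zeroSet (by omega), h.desc_dropMax_zeroSet (by omega)]
    exact this.2 _ (by omega) (by omega) (by omega)

theorem interlacesBoth_dropMax (h : IsRecSeq a b c t r W) (hr : -c / b < r) {n : ℕ}
    (hn : 3 ≤ n) :
    InterlacesBoth (dropMax (zeroSet (W (n + 2)))) (dropMax (zeroSet (W n))) := by
  have := h.interlace_add_two_of_gt hr (n := n) (by omega)
  apply interlacesBoth_of_desc <;>
    simp only [h.card_dropMax_zeroSet (show 1 ≤ n by omega),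
      h.card_dropMax_zeroSet (show 1 ≤ n + 2 by omega)]
  · omega
  · intro k hk
    rw [h.desc_dropMax_zeroSet (by omega), h.desc_dropMax_zeroSet (by omega),
      h.desc_dropMax_zeroSet (by omega)]
    exact ⟨this.1 _ (by omega) (by omega), this.2 _ (by omega) (by omega) (by omega)⟩

theorem increasesTo_of_lt (h : IsRecSeq a b c t r W) (hr : r < -c / b) {i : ℕ} {x : ℝ}
    (hx : Tendsto (fun n => descRoot W n i) atTop (𝓝 x)) :
    IncreasesTo (fun n => descRoot W n i) (2 * i + 1) x :=
  ⟨strictMonoOn_Ici_of_lt_succ fun _ hn =>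
    (h.interlace_succ_of_lt hr (by omega)).1 i (by omega), hx⟩

theorem increasesTo_of_gt (h : IsRecSeq a b c t r W) (hr : -c / b < r) {i : ℕ} (hi : 1 ≤ i) :
    IncreasesTo (fun n => descRoot W n i) (2 * i + 1) (xStar a b c) :=
  ⟨strictMonoOn_Ici_of_lt_succ fun _ hn =>
    (h.interlace_succ_of_gt hr (by omega)).1 i hi (by omega), h.tendsto_descRoot hi⟩

theorem increasesTo_even (h : IsRecSeq a b c t r W) (hr : -c / b < r) :
    IncreasesTo (fun n => descRoot W (2 * n) 0) 1 (yStar a b c t r) :=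
  ⟨strictMonoOn_Ici_of_lt_succ fun _ hn => h.descRoot_zero_even_lt hr hn,
    (h.tendsto_descRoot_zero_of_gt (h.rStar_lt_xStar.trans (h.xStar_lt.trans hr))).comp
      (tendsto_atTop_mono (fun n => show n ≤ 2 * n by omega) tendsto_id)⟩

theorem decreasesTo_odd (h : IsRecSeq a b c t r W) (hr : -c / b < r) :
    DecreasesTo (fun n => descRoot W (2 * n - 1) 0) 1 (yStar a b c t r) :=
  ⟨strictAntiOn_Ici_of_succ_lt fun _ hn => h.descRoot_zero_odd_lt hr hn,
    (h.tendsto_descRoot_zero_of_gt (h.rStar_lt_xStar.trans (h.xStar_lt.trans hr))).comp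
      (tendsto_atTop_mono (fun n => show n ≤ 2 * n - 1 by omega) tendsto_id)⟩

theorem descRoot_mem (h : IsRecSeq a b c t r W) {n k : ℕ} (hk : k < (n + 1) / 2) :
    descRoot W n k ∈ zeroSet (W n) :=
  desc_mem (by rwa [h.card_zeroSet])

theorem le_descRoot_zero {n : ℕ} {x : ℝ} (hx : x ∈ zeroSet (W n)) : x ≤ descRoot W n 0 := by
  obtain ⟨k, hk, rfl⟩ := exists_desc_eq hx
  exact desc_le_desc k.zero_le hk

theorem exists_zero_lt (h : IsRecSeq a b c t r W) (z : ℝ) :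
    ∃ x ∈ {x | ∃ n, 1 ≤ n ∧ x ∈ zeroSet (W n)}, x < z := by
  obtain ⟨n, hn, hlt⟩ := ((eventually_ge_atTop 1).and
    ((h.tendsto_descRoot_atBot le_rfl).eventually_lt_atBot z)).exists
  exact ⟨_, ⟨n, hn, h.descRoot_mem (by omega)⟩, hlt⟩

theorem isBestBound_Iio_of_increasesTo (h : IsRecSeq a b c t r W) {x : ℝ}
    (hx : IncreasesTo (fun n => descRoot W n 0) 1 x) :
    IsBestBound {x | ∃ n, 1 ≤ n ∧ x ∈ zeroSet (W n)} (Set.Iio x) := by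
  refine isBestBound_Iio ?_ h.exists_zero_lt fun z hz => ?_
  · rintro y ⟨n, hn, hy⟩
    exact (le_descRoot_zero hy).trans_lt (hx.lt hn)
  · obtain ⟨n, hn, hlt⟩ := ((eventually_ge_atTop 1).and (hx.2.eventually_const_lt hz)).exists
    exact ⟨_, ⟨n, hn, h.descRoot_mem (by omega)⟩, hlt⟩

theorem isBestBound_Iic_of_gt (h : IsRecSeq a b c t r W) (hr : -c / b < r) :
    IsBestBound {x | ∃ n, 1 ≤ n ∧ x ∈ zeroSet (W n)} (Set.Iic r) := by
  refine isBestBound_Iic ?_ h.exists_zero_lt ⟨1, le_rfl, ?_⟩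
  · rintro y ⟨n, hn, hy⟩
    refine (le_descRoot_zero hy).trans ?_
    have hyr : yStar a b c t r < r := by
      simpa [h.descRoot_one_zero] using (h.decreasesTo_odd hr).lt (le_refl 1)
    rcases Nat.even_or_odd' n with ⟨m, rfl | rfl⟩
    · exact (((h.increasesTo_even hr).lt (n := m) (by omega)).trans hyr).le
    · have := (h.decreasesTo_odd hr).1.antitoneOn (a := 1) (b := m + 1) (by simp) (by simp)
        (by omega)
      simpa [h.descRoot_one_zero, show 2 * (m + 1) - 1 = 2 * m + 1 by omega] using this
  · have := h.descRoot_mem (n := 1) (k := 0) (by norm_num)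
    rwa [h.descRoot_one_zero] at this

end IsRecSeq

theorem theorem1 (a b c t r : ℝ) (ha : 0 < a) (hb : 0 < b) (ht : 0 < t) (hr : r ≠ -c / b)
    (W : ℕ → ℝ[X]) (hW0 : W 0 = 1) (hW1 : W 1 = C t * (X - C r))
    (hW : ∀ n, 2 ≤ n → W n = C a * W (n - 1) + (C b * X + C c) * W (n - 2))
    (d : ℕ → ℕ) (hd : ∀ n, d n = (n + 1) / 2)
    (R R' : ℕ → Finset ℝ) (hR : ∀ n, R n = zeroSet (W n)) (hR' : ∀ n, R' n = dropMax (R n))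
    (ξ : ℕ → ℕ → ℝ) (hξ : ∀ n i, ξ n i = nth (R n) i) :
    -- degree and distinct-real-rootedness
    (∀ n, (W n).degree = (d n : WithBot ℕ) ∧ DistinctRealRooted (W n) ∧ (R n).card = d n) ∧
    -- first regime
    (r ≤ rStar a b c t →
      (∀ n, 1 ≤ n → InterlacesRight (R (n + 1)) (R n)) ∧
      (∀ n, 1 ≤ n → InterlacesBoth (R (n + 2)) (R n)) ∧
      (∀ i, IncreasesTo (fun n => ξ n (d n - i)) (2 * i + 1) (xStar a b c)) ∧
      IsBestBound {x | ∃ n, 1 ≤ n ∧ x ∈ R n} (Set.Iio (xStar a b c))) ∧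
    -- second regime
    (rStar a b c t < r → r < -c / b →
      (∀ n, 1 ≤ n → InterlacesRight (R (n + 1)) (R n)) ∧
      (∀ n, 1 ≤ n → InterlacesBoth (R (n + 2)) (R n)) ∧
      (∀ i, 1 ≤ i → IncreasesTo (fun n => ξ n (d n - i)) (2 * i + 1) (xStar a b c)) ∧
      IncreasesTo (fun n => ξ n (d n)) 1 (yStar a b c t r) ∧
      xStar a b c < yStar a b c t r ∧
      IsBestBound {x | ∃ n, 1 ≤ n ∧ x ∈ R n} (Set.Iio (yStar a b c t r))) ∧
    -- third regime
    (-c / b < r →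
      (∀ n, 3 ≤ n → InterlacesRight (R' (n + 1)) (R' n)) ∧
      (∀ n, 3 ≤ n → InterlacesBoth (R' (n + 2)) (R' n)) ∧
      (∀ i, 1 ≤ i → IncreasesTo (fun n => ξ n (d n - i)) (2 * i + 1) (xStar a b c)) ∧
      IncreasesTo (fun n => ξ (2 * n) (d (2 * n))) 1 (yStar a b c t r) ∧
      DecreasesTo (fun n => ξ (2 * n - 1) (d (2 * n - 1))) 1 (yStar a b c t r) ∧
      xStar a b c < -c / b ∧ -c / b < ξ 2 (d 2) ∧ ξ 2 (d 2) < yStar a b c t r ∧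
      yStar a b c t r < ξ 1 (d 1) ∧ ξ 1 (d 1) = r ∧
      IsBestBound {x | ∃ n, 1 ≤ n ∧ x ∈ R n} (Set.Iic r)) ∧
    -- the roots of fixed index
    (∀ i, 1 ≤ i → Tendsto (fun n => ξ n i) atTop atBot) := by
  have h : IsRecSeq a b c t r W := ⟨ha, hb, ht, hW0, hW1, fun n => hW (n + 2) (by omega)⟩
  obtain rfl : R = fun n => zeroSet (W n) := funext hR
  obtain rfl : R' = fun n => dropMax (zeroSet (W n)) := funext hR'
  have hdesc : ∀ n i, ξ n (d n - i) = descRoot W n i := fun n i => by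
    rw [hξ, hd, descRoot, desc, h.card_zeroSet]
  have hdesc0 : ∀ n, ξ n (d n) = descRoot W n 0 := fun n => hdesc n 0
  simp only [hdesc, hdesc0]
  refine ⟨fun n => ⟨?_, (h.simpleRealRooted n).distinctRealRooted, ?_⟩, ?_, ?_, ?_, ?_⟩
  · rw [hd, degree_eq_natDegree, h.natDegree_eq]
    exact fun h0 => by simpa [h0] using h.leadingCoeff_pos n
  · rw [hd, h.card_zeroSet]
  · intro hr1
    have hr2 := hr1.trans_lt (h.rStar_lt_xStar.trans h.xStar_lt)
    have hlim := h.tendsto_descRoot_zero_of_le hr1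
    refine ⟨fun n => h.interlacesRight_of_lt hr2, fun n => h.interlacesBoth_of_lt hr2,
      fun i => h.increasesTo_of_lt hr2 ?_,
      h.isBestBound_Iio_of_increasesTo (h.increasesTo_of_lt hr2 hlim)⟩
    rcases Nat.eq_zero_or_pos i with rfl | hi
    · exact hlim
    · exact h.tendsto_descRoot hi
  · intro hr1 hr2
    have hlim := h.increasesTo_of_lt hr2 (h.tendsto_descRoot_zero_of_gt hr1)
    exact ⟨fun n => h.interlacesRight_of_lt hr2, fun n => h.interlacesBoth_of_lt hr2,
      fun i hi => h.increasesTo_of_lt hr2 (h.tendsto_descRoot hi), hlim, (h.yStar_spec hr1).1,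
      h.isBestBound_Iio_of_increasesTo hlim⟩
  · intro hr1
    have hodd := h.decreasesTo_odd hr1
    have hlast := hodd.lt (le_refl 1)
    exact ⟨fun n => h.interlacesRight_dropMax hr1, fun n => h.interlacesBoth_dropMax hr1,
      fun i => h.increasesTo_of_gt hr1, h.increasesTo_even hr1, hodd, h.xStar_lt,
      h.neg_div_lt_descRoot hr1 (by omega), (h.increasesTo_even hr1).lt (le_refl 1), hlast,
      h.descRoot_one_zero, h.isBestBound_Iic_of_gt hr1⟩
  · intro i hi
    refine (h.tendsto_descRoot_atBot hi).congr' ?_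
    filter_upwards [eventually_ge_atTop (2 * i)] with n hn
    rw [hξ, nth_eq_desc (by rw [h.card_zeroSet]; omega), h.card_zeroSet]
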